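/- Conventions. An incidence structure $(V,\mathcal B)$ consists of a finite set $V$ of points and a finite multiset $\mathcal B$ of subsets of $V$, called blocks. For integers $1\le t\le k\le v$ and $\lambda\ge 1$, it is a $t$-$(v,k,\lambda)$ covering if $|V|=v$, every block has exactly $k$ points, and every $t$-subset of $V$ is contained in at least $\lambda$ blocks (counted with multiplicity). The covering number $C_\lambda(v,k,t)$ is the minimum number of blocks in a $t$-$(v,k,\lambda)$ covering, and $C_\lambda(v,k,0)=\lambda$. The Schönheim number $L_\lambda(v,k,t)$ is defined by $L_\lambda(v,k,0)=\lambda$ and $L_\lambda(v,k,t)=\left\lceil \frac{v}{k}L_\lambda(v-1,k-1,t-1)\right\rceil$ for $t\ge1$. **Theorem.** Let $t,v,k,\lambda,s$ be positive integers with $t<k<v$ and $s\le\lfloor t/2\rfloor$, and let $b_s,b_{s+1},\ldots,b_{2s}$ be positive integers. Put $$a_j=\sum_{i=0}^{j}(-1)^{i+j}\binom{j}{i}b_{2s-i}\quad(0\le j\le s),\qquad d=b_s\left(\binom ks-1\right)-\sum_{i=0}^{s-1}\binom si\binom{v-s}{s-i}b_{2s-i}.$$ Suppose that (i) $L_\lambda(v-2s,k-2s,t-2s)\le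 b_{2s}\le C_\lambda(v-2s,k-2s,t-2s)$; (ii) $\left\lceil\frac{v-i}{k-i}\,b_{i+1}\right\rceil\le b_i\le C_\lambda(v-i,k-i,t-i)$ for $i=s,s+1,\ldots,2s-1$; (iii) $a_j\ge0$ for $j=0,1,\ldots,s$; and that $b_s<\binom ks$ and $d\ge a_s\ge1$. Then $$C_\lambda(v,k,t)\ \ge\ \left\lceil \frac{b_s(\alpha-\beta)\binom vs+\alpha\binom vs}{(\alpha-\beta)\binom ks+1}\right\rceil,\qquad\text{where}\quad \alpha=\frac{a_s+1}{2(d+1)},\quad \beta=\frac{a_s+1}{2\left(d+\binom ks\right)}.$$ -/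

import Mathlib

namespace CoveringDesign

/-- `b(X)`: the number of blocks (counted with multiplicity) of the incidence structure with block
multiset `𝓑` that contain the point set `X`. -/
def blockCount {V : Type*} [DecidableEq V] (𝓑 : Multiset (Finset V)) (X : Finset V) : ℕ :=
  𝓑.countP (fun B => X ⊆ B)

/-- The incidence structure with point set `V` and block multiset `𝓑` is a `t`-`(v,k,lam)`
covering: there are `v` points, every block has size `k`, and every `t`-subset of points lies in at
least `lam` blocks. -/
structure IsCovering {V : Type*} [Fintype V] [DecidableEq V] (t v k lam : ℕ)
    (𝓑 : Multiset (Finset V)) : Prop where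
  card_points : Fintype.card V = v
  card_block : ∀ B ∈ 𝓑, B.card = k
  le_blockCount : ∀ T : Finset V, T.card = t → lam ≤ blockCount 𝓑 T

/-- The covering number `C_lam(v,k,t)`: the minimum number of blocks in any `t`-`(v,k,lam)`
covering, with the convention `C_lam(v,k,0) = lam`. The number of blocks is invariant under
relabelling points, so the point set is taken to be `Fin v`. Coverings exist whenever
`t ≤ k ≤ v`, so then the infimum is a minimum. -/
noncomputable def coveringNumber (lam v k t : ℕ) : ℕ :=
  if t = 0 then lam
  else sInf {n : ℕ | ∃ 𝓑 : Multiset (Finset (Fin v)), IsCovering t v k lam 𝓑 ∧ 𝓑.card = n}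

/-- The Schönheim number `L_lam(v,k,t) = ⌈v/k ⌈(v-1)/(k-1) ⋯ ⌈lam (v-t+1)/(k-t+1)⌉ ⋯ ⌉⌉`, with
`L_lam(v,k,0) = lam`. -/
def schoenheim (lam : ℕ) : ℕ → ℕ → ℕ → ℕ
  | _, _, 0 => lam
  | v, k, t + 1 => ⌈(v : ℚ) / (k : ℚ) * (schoenheim lam (v - 1) (k - 1) t : ℚ)⌉₊

/-- `a_j = ∑_{i=0}^{j} (-1)^{i+j} (j choose i) b_{2s-i}`. -/
def aCoeff (s : ℕ) (b : ℕ → ℕ) (j : ℕ) : ℤ :=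
  ∑ i ∈ Finset.range (j + 1), (-1 : ℤ) ^ (i + j) * (j.choose i : ℤ) * (b (2 * s - i) : ℤ)

/-- `d = b_s ((k choose s) - 1) - ∑_{i=0}^{s-1} (s choose i) (v-s choose s-i) b_{2s-i}`. -/
def dParam (v k s : ℕ) (b : ℕ → ℕ) : ℤ :=
  (b s : ℤ) * ((k.choose s : ℤ) - 1)
    - ∑ i ∈ Finset.range s,
        (s.choose i : ℤ) * ((v - s).choose (s - i) : ℤ) * (b (2 * s - i) : ℤ)

/-- `CB(α,β) = (b_s (α-β) (v choose s) + α (v choose s)) / ((α-β) (k choose s) + 1)`; the argument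
`bs` is the number `b_s`. -/
noncomputable def CB (v k s bs : ℕ) (α β : ℝ) : ℝ :=
  ((bs : ℝ) * (α - β) * (v.choose s : ℝ) + α * (v.choose s : ℝ))
    / ((α - β) * (k.choose s : ℝ) + 1)

end CoveringDesign

/-! Take a minimum covering. Derived coverings give `b #Z ≤ blockCount 𝓑 Z` whenever `s ≤ #Z ≤ 2 *
s`. Join distinct `s`-sets `X`, `Y` by `excess 𝓑 b X Y` parallel edges; by `sum_excess`, `X` has
degree `d + (blockCount 𝓑 X - b s) * (k.choose s - 1)`. If `S` induces degrees below `a_s`, the Gram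
matrix of its block-incidence vectors is a prescribed part at least `a_s • 1`, plus the excess part
at least `-(a_s - 1) • 1`, plus a nonnegative diagonal. It is positive definite, so `#S ≤ 𝓑.card`
(`card_le_card_blocks_of_sparse`). Caro–Tuza (`exists_sparse_subset`) yields such an `S` at least as
large as a sum of convex functions of the degrees. Chords (`chord_le`) make this linear in
`blockCount 𝓑 X`, whose total is `𝓑.card * k.choose s`; solving for `𝓑.card` gives `CB`. -/

namespace CoveringDesign

open Finset

/-! ### Sparse induced subgraphs of multigraphs -/

/-- The Caro–Tuza weight: a lower bound for the contribution of a vertex of degree `n` to a largest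
subset inducing maximum degree less than `m`. -/
noncomputable def sparseWeight (m n : ℕ) : ℝ :=
  if n ≤ m then 1 - (n : ℝ) / (2 * m) else ((m : ℝ) + 1) / (2 * ((n : ℝ) + 1))

theorem sparseWeight_of_le {m n : ℕ} (hm : 0 < m) (h : m ≤ n) :
    sparseWeight m n = ((m : ℝ) + 1) / (2 * ((n : ℝ) + 1)) := by
  unfold sparseWeight
  have : (0 : ℝ) < m := by exact_mod_cast hm
  split_ifs with h'
  · obtain rfl : n = m := le_antisymm h' h
    field_simp
    norm_num
  · rfl

theorem sparseWeight_le_one {m n : ℕ} : sparseWeight m n ≤ 1 := by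
  unfold sparseWeight
  split_ifs with h'
  · have : (0 : ℝ) ≤ (n : ℝ) / (2 * m) := by positivity
    linarith
  · have : (m : ℝ) ≤ n := by exact_mod_cast (not_le.1 h').le
    rw [div_le_one (by positivity)]
    have : (0 : ℝ) ≤ n := by positivity
    linarith

/-- The weight is convex in the degree, so up to degree `D` its smallest unit drop is the last one,
from `D - 1` to `D`. -/
theorem sparseWeight_sub_succ {m n D : ℕ} (hm : 0 < m) (hD : m ≤ D) (hn : n + 1 ≤ D) :
    ((m : ℝ) + 1) / (2 * D * (D + 1)) ≤ sparseWeight m n - sparseWeight m (n + 1) := by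
  have hm' : (0 : ℝ) < m := by exact_mod_cast hm
  have hD' : (m : ℝ) ≤ D := by exact_mod_cast hD
  have hn' : (n : ℝ) + 1 ≤ D := by exact_mod_cast hn
  have hn0 : (0 : ℝ) ≤ n := by positivity
  rcases lt_or_ge n m with h | h
  · have : sparseWeight m n - sparseWeight m (n + 1) = 1 / (2 * m) := by
      unfold sparseWeight
      rw [if_pos h.le, if_pos (by omega)]
      push_cast
      field_simp
      ring
    have hD0 : (0 : ℝ) < D := hm'.trans_le hD'
    rw [this, div_le_div_iff₀ (by positivity) (by positivity)]
    nlinarith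
  · have : sparseWeight m n - sparseWeight m (n + 1)
        = ((m : ℝ) + 1) / (2 * (n + 1) * (n + 1 + 1)) := by
      rw [sparseWeight_of_le hm h, sparseWeight_of_le hm (by omega)]
      push_cast
      field_simp
      ring
    rw [this]
    gcongr

theorem sparseWeight_sub_le {m D : ℕ} (hm : 0 < m) (hD : m ≤ D) (n c : ℕ) (hn : n + c ≤ D) :
    c * (((m : ℝ) + 1) / (2 * D * (D + 1))) ≤ sparseWeight m n - sparseWeight m (n + c) := by
  induction c with
  | zero => simp
  | succ c ih =>
    have h1 := ih (by omega)
    have h2 := sparseWeight_sub_succ (n := n + c) hm hD (by omega)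
    rw [← add_assoc]
    push_cast
    linarith

/-- The Caro–Tuza bound for multigraphs. -/
theorem exists_sparse_subset {α : Type*} [DecidableEq α] (e : α → α → ℕ)
    (hsymm : ∀ x y, e x y = e y x) (hirr : ∀ x, e x x = 0) {m : ℕ} (hm : 0 < m) (W : Finset α) :
    ∃ S ⊆ W, (∀ x ∈ S, ∑ y ∈ S, e x y < m) ∧
      ∑ x ∈ W, sparseWeight m (∑ y ∈ W, e x y) ≤ (S.card : ℝ) := by
  induction W using Finset.strongInduction with
  | H W ih =>
    by_cases hall : ∀ x ∈ W, ∑ y ∈ W, e x y < m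
    · refine ⟨W, Subset.rfl, hall, ?_⟩
      calc _ ≤ ∑ x ∈ W, (1 : ℝ) := sum_le_sum fun _ _ => sparseWeight_le_one
        _ = _ := by simp
    · push Not at hall
      obtain ⟨x₀, hx₀, hd₀⟩ := hall
      -- Delete a vertex of maximum degree `D`: the weight gained by its neighbours pays for the
      -- weight lost.
      obtain ⟨z, hz, hmax⟩ := exists_max_image W (fun x => ∑ y ∈ W, e x y) ⟨x₀, hx₀⟩
      set D := ∑ y ∈ W, e z y with hDdef
      have hmD : m ≤ D := hd₀.trans (hmax x₀ hx₀)
      obtain ⟨S, hSW, hS, hcard⟩ := ih (W.erase z) (erase_ssubset hz)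
      refine ⟨S, hSW.trans (erase_subset _ _), hS, le_trans ?_ hcard⟩
      have hdeg : ∀ x, ∑ y ∈ W, e x y = ∑ y ∈ W.erase z, e x y + e x z := fun x =>
        (sum_erase_add W _ hz).symm
      set c : ℝ := ((m : ℝ) + 1) / (2 * D * (D + 1)) with hc
      have hstep : ∀ x ∈ W.erase z, sparseWeight m (∑ y ∈ W, e x y) + (e z x : ℝ) * c
          ≤ sparseWeight m (∑ y ∈ W.erase z, e x y) := by
        intro x hx
        have h1 := hmax x (mem_of_mem_erase hx)
        simp only [hdeg x] at h1 ⊢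
        have h2 := sparseWeight_sub_le hm hmD _ _ h1
        rw [hsymm z x]
        linarith
      have hsum := sum_le_sum hstep
      rw [sum_add_distrib, ← sum_mul] at hsum
      have hDsum : (∑ x ∈ W.erase z, (e z x : ℝ)) = D := by
        have := hdeg z
        rw [hirr, add_zero, ← hDdef] at this
        rw [this]; push_cast; rfl
      rw [← sum_erase_add W _ hz, ← hDdef, sparseWeight_of_le hm hmD]
      rw [hDsum] at hsum
      have hDpos : (0 : ℝ) < D := by exact_mod_cast lt_of_lt_of_le hm hmD
      -- The `D` edges at `z` each gain at least `c`, in total exactly the weight of `z`.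
      have : (D : ℝ) * c = ((m : ℝ) + 1) / (2 * ((D : ℝ) + 1)) := by
        rw [hc]; field_simp
      linarith

/-- Extrapolating a chord of the convex function `x ↦ (m + 1) / (2 (x + 1))`. -/
theorem chord_le {A d g n : ℝ} (hA : 0 ≤ A) (hd : 0 ≤ d) (hg : 0 ≤ g) (hn : n = 0 ∨ 1 ≤ n) :
    A / (2 * (d + 1)) - (A / (2 * (d + 1)) - A / (2 * (d + (g + 1)))) * n
      ≤ A / (2 * (d + n * g + 1)) := by
  rcases hn with rfl | hn
  · simp
  -- The chord meets the curve at `n = 0` and `n = 1`, hence the factor `n * (n - 1)`.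
  · have h : A / (2 * (d + n * g + 1)) - (A / (2 * (d + 1))
        - (A / (2 * (d + 1)) - A / (2 * (d + (g + 1)))) * n)
        = A * g ^ 2 * n * (n - 1) / (2 * (d + 1) * (d + (g + 1)) * (d + n * g + 1)) := by
      have h1 : d + 1 ≠ 0 := by positivity
      have h2 : d + (g + 1) ≠ 0 := by positivity
      have h3 : d + n * g + 1 ≠ 0 := by positivity
      field_simp
      ring
    have : 0 ≤ A * g ^ 2 * n * (n - 1) / (2 * (d + 1) * (d + (g + 1)) * (d + n * g + 1)) := by
      have : 0 ≤ n - 1 := by linarith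
      positivity
    linarith

/-! ### Derived coverings and existence of coverings -/

theorem blockCount_eq_card {V : Type*} [DecidableEq V] (𝓑 : Multiset (Finset V)) (X : Finset V) :
    blockCount 𝓑 X = #{i : 𝓑 | X ⊆ i.1} := by
  conv_lhs => rw [blockCount, ← Multiset.map_univ_coe 𝓑]
  rw [Multiset.countP_map]
  rfl

/-- The blocks containing `Z`, with `Z` removed, form a covering. -/
theorem coveringNumber_le_blockCount {t v k lam : ℕ} {𝓑 : Multiset (Finset (Fin v))}
    (h𝓑 : IsCovering t v k lam 𝓑) (Z : Finset (Fin v)) (hZ : #Z ≤ t) :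
    coveringNumber lam (v - #Z) (k - #Z) (t - #Z) ≤ blockCount 𝓑 Z := by
  unfold coveringNumber
  split_ifs with h0
  -- Here `#Z = t`, and the convention `C_lam(_,_,0) = lam` is the covering condition itself.
  · exact h𝓑.le_blockCount Z (by omega)
  · have hcard : #Zᶜ = v - #Z := by simp [card_compl]
    let φ : Fin (v - #Z) ↪ Fin v := (Zᶜ.orderEmbOfFin hcard).toEmbedding
    have hφ : univ.map φ = Zᶜ := by simp [φ]
    let ψ : Finset (Fin v) → Finset (Fin (v - #Z)) := fun B => {a | φ a ∈ B}
    have hψ : ∀ B, (ψ B).map φ = B \ Z := by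
      intro B
      ext x
      have : x ∉ Z ↔ ∃ a, φ a = x := by
        rw [← mem_compl, ← hφ]; simp
      simp only [mem_map, mem_sdiff, this, ψ, mem_filter, mem_univ, true_and]
      constructor
      · rintro ⟨a, h, rfl⟩; exact ⟨h, a, rfl⟩
      · rintro ⟨h, a, rfl⟩; exact ⟨a, h, rfl⟩
    refine Nat.sInf_le ⟨(𝓑.filter (Z ⊆ ·)).map ψ, ⟨by simp, ?_, ?_⟩, ?_⟩
    · intro B' hB'
      obtain ⟨B, hB, rfl⟩ := Multiset.mem_map.1 hB'
      rw [Multiset.mem_filter] at hB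
      rw [← card_map φ, hψ, card_sdiff_of_subset hB.2, h𝓑.card_block B hB.1]
    · intro T hT
      have hdisj : Disjoint Z (T.map φ) := by
        rw [← le_compl_iff_disjoint_left, ← hφ]
        exact map_subset_map.2 (subset_univ _)
      have := h𝓑.le_blockCount (Z ∪ T.map φ) (by rw [card_union_of_disjoint hdisj, card_map]; omega)
      refine this.trans (le_of_eq ?_)
      unfold blockCount
      rw [Multiset.countP_map, ← Multiset.countP_eq_card_filter, Multiset.countP_filter]
      refine Multiset.countP_congr rfl fun B _ => ?_
      simp only [union_subset_iff, eq_iff_iff, ψ]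
      rw [and_comm]
      refine and_congr ?_ Iff.rfl
      simp [subset_iff]
    · rw [Multiset.card_map, blockCount, Multiset.countP_eq_card_filter]

/-- Take `lam` copies of every `k`-subset. This rules out the default value `sInf ∅ = 0`. -/
theorem exists_isCovering {t v k : ℕ} (lam : ℕ) (htk : t ≤ k) (hkv : k ≤ v) :
    ∃ 𝓑 : Multiset (Finset (Fin v)), IsCovering t v k lam 𝓑 := by
  refine ⟨lam • (powersetCard k univ).val, by simp, ?_, ?_⟩
  · intro B hB
    have := Multiset.mem_of_mem_nsmul hB
    simpa using this
  · intro T hT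
    obtain ⟨B, hTB, hB⟩ := exists_superset_card_eq (s := T) (n := k) (by omega) (by simpa)
    unfold blockCount
    rw [Multiset.countP_nsmul]
    refine Nat.le_mul_of_pos_right _ (Multiset.countP_pos.2 ⟨B, ?_, hTB⟩)
    simpa using hB

/-! ### Quadratic forms and linear independence -/

/-- `aCoeff s b j` is the `j`-th forward difference at `0` of `i ↦ b (2 * s - i)`; this is Newton's
formula. -/
theorem sum_choose_mul_aCoeff (s : ℕ) (b : ℕ → ℕ) (m : ℕ) :
    ∑ j ∈ range (m + 1), (m.choose j : ℤ) * aCoeff s b j = b (2 * s - m) := by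
  have h := shift_eq_sum_fwdDiff_iter (1 : ℕ) (fun i => (b (2 * s - i) : ℤ)) m 0
  simp only [smul_eq_mul, mul_one, zero_add, nsmul_eq_mul] at h
  rw [h]
  refine sum_congr rfl fun j _ => ?_
  rw [fwdDiff_iter_eq_sum_shift]
  unfold aCoeff
  congr 1
  refine sum_congr rfl fun i hi => ?_
  have : j - i + 2 * i = i + j := by simp at hi; omega
  simp only [smul_eq_mul, mul_one, zero_add]
  rw [← this, pow_add, pow_mul]
  simp

theorem sum_sq_indicator {ι σ : Type*} [Fintype σ] (I : Finset ι) (P : ι → σ → Prop)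
    [∀ i x, Decidable (P i x)] (w : σ → ℝ) :
    ∑ i ∈ I, (∑ x, if P i x then w x else 0) ^ 2
      = ∑ x, ∑ y, w x * w y * (#{i ∈ I | P i x ∧ P i y} : ℝ) := by
  simp_rw [sq, sum_mul_sum]
  rw [sum_comm]
  refine sum_congr rfl fun x _ => ?_
  rw [sum_comm]
  refine sum_congr rfl fun y _ => ?_
  rw [card_filter, Nat.cast_sum, mul_sum]
  refine sum_congr rfl fun i _ => ?_
  by_cases h1 : P i x <;> by_cases h2 : P i y <;> simp [h1, h2]

/-- The excess of the number of blocks containing `X ∪ Y` over the prescribed lower bound. -/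
def excess {V : Type*} [DecidableEq V] (𝓑 : Multiset (Finset V)) (b : ℕ → ℕ)
    (X Y : Finset V) : ℕ :=
  -- For `s`-sets the truncated subtraction is exact once `b #Z ≤ blockCount 𝓑 Z` for `s ≤ #Z ≤ 2 *
  -- s`.
  if X = Y then 0 else blockCount 𝓑 (X ∪ Y) - b #(X ∪ Y)

theorem excess_comm {V : Type*} [DecidableEq V] (𝓑 : Multiset (Finset V)) (b : ℕ → ℕ)
    (X Y : Finset V) : excess 𝓑 b X Y = excess 𝓑 b Y X := by
  simp only [excess, union_comm X Y, eq_comm (a := X)]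

theorem excess_self {V : Type*} [DecidableEq V] (𝓑 : Multiset (Finset V)) (b : ℕ → ℕ)
    (X : Finset V) : excess 𝓑 b X X = 0 := by
  simp [excess]

section Design

variable {V : Type*} [Fintype V] [DecidableEq V]

/-- Newton's formula makes the form a combination, with coefficients `a_j ≥ 0`, of sums of squares
indexed by the `j`-sets `J`. For `j = s`, the sets `J = A x` alone contribute `∑ x, w x ^ 2`. -/
theorem quadratic_prescribed_ge {σ : Type*} [Fintype σ] {s : ℕ} {b : ℕ → ℕ}
    (A : σ → Finset V) (hA : Function.Injective A) (hcard : ∀ x, #(A x) = s)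
    (ha : ∀ j ∈ range (s + 1), 0 ≤ aCoeff s b j) (w : σ → ℝ) :
    (aCoeff s b s : ℝ) * ∑ x, w x ^ 2
      ≤ ∑ x, ∑ y, w x * w y * (b (2 * s - #(A x ∩ A y)) : ℝ) := by
  have hb : ∀ x y, (b (2 * s - #(A x ∩ A y)) : ℝ)
      = ∑ j ∈ range (s + 1), (aCoeff s b j : ℝ)
          * (#{J ∈ powersetCard j (univ : Finset V) | J ⊆ A x ∧ J ⊆ A y} : ℝ) := by
    intro x y
    have hle : #(A x ∩ A y) ≤ s := (hcard x) ▸ card_le_card inter_subset_left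
    have h := congrArg (Int.cast : ℤ → ℝ) (sum_choose_mul_aCoeff s b #(A x ∩ A y))
    push_cast at h
    rw [← h]
    refine (sum_subset (range_mono (by omega)) fun j _ hj => ?_).trans
      (sum_congr rfl fun j _ => ?_)
    · rw [Nat.choose_eq_zero_of_lt (by simpa using hj)]; simp
    · rw [mul_comm, ← card_powersetCard]
      congr 3
      ext J
      simp only [mem_powersetCard, mem_filter, subset_univ, true_and, subset_inter_iff]
      tauto
  have hrw : ∑ x, ∑ y, w x * w y * (b (2 * s - #(A x ∩ A y)) : ℝ)
      = ∑ j ∈ range (s + 1), (aCoeff s b j : ℝ)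
        * ∑ J ∈ powersetCard j (univ : Finset V), (∑ x, if J ⊆ A x then w x else 0) ^ 2 := by
    simp_rw [sum_sq_indicator, hb, mul_sum]
    rw [sum_comm_cycle]
    refine sum_congr rfl fun j _ => sum_congr rfl fun x _ => sum_congr rfl fun y _ => by ring
  rw [hrw]
  refine le_trans ?_ (single_le_sum (f := fun j => (aCoeff s b j : ℝ)
    * ∑ J ∈ powersetCard j (univ : Finset V), (∑ x, if J ⊆ A x then w x else 0) ^ 2)
    (fun j hj => mul_nonneg (by exact_mod_cast ha j hj) (sum_nonneg fun _ _ => sq_nonneg _))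
    (self_mem_range_succ s))
  refine mul_le_mul_of_nonneg_left ?_ (by exact_mod_cast ha s (self_mem_range_succ s))
  have himage : ∑ x, w x ^ 2
      = ∑ J ∈ univ.image A, (∑ x, if J ⊆ A x then w x else 0) ^ 2 := by
    rw [sum_image hA.injOn]
    refine sum_congr rfl fun x _ => ?_
    congr 1
    rw [sum_eq_single x]
    · simp
    · intro y _ hy
      rw [if_neg]
      intro h
      exact hy (hA (eq_of_subset_of_card_le h (by simp [hcard]))).symm
    · simp
  rw [himage]
  refine sum_le_sum_of_subset_of_nonneg ?_ fun _ _ _ => sq_nonneg _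
  intro J hJ
  obtain ⟨x, -, rfl⟩ := mem_image.1 hJ
  simp [mem_powersetCard, hcard]

theorem sum_weight_ge {σ : Type*} [Fintype σ] (e : σ → σ → ℝ) (he : ∀ x y, 0 ≤ e x y)
    (hsymm : ∀ x y, e x y = e y x) {a : ℝ} (hdeg : ∀ x, ∑ y, e x y ≤ a) (w : σ → ℝ) :
    -(a * ∑ x, w x ^ 2) ≤ ∑ x, ∑ y, w x * w y * e x y := by
  have h1 : ∑ x, ∑ y, w x ^ 2 * e x y ≤ a * ∑ x, w x ^ 2 := by
    rw [mul_sum]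
    refine sum_le_sum fun x _ => ?_
    rw [← mul_sum, mul_comm]
    exact mul_le_mul_of_nonneg_right (hdeg x) (sq_nonneg _)
  have h2 : ∑ x, ∑ y, w y ^ 2 * e x y = ∑ x, ∑ y, w x ^ 2 * e x y := by
    rw [sum_comm]
    simp_rw [hsymm]
  have h3 : 0 ≤ ∑ x, ∑ y, (w x + w y) ^ 2 * e x y :=
    sum_nonneg fun x _ => sum_nonneg fun y _ => mul_nonneg (sq_nonneg _) (he x y)
  have h4 : ∑ x, ∑ y, (w x + w y) ^ 2 * e x y = ∑ x, ∑ y, w x ^ 2 * e x y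
      + ∑ x, ∑ y, w y ^ 2 * e x y + 2 * ∑ x, ∑ y, w x * w y * e x y := by
    simp_rw [mul_sum, ← sum_add_distrib]
    refine sum_congr rfl fun x _ => sum_congr rfl fun y _ => by ring
  linarith

/-- The incidence vectors of a family of `s`-sets with small mutual excess are linearly
independent. -/
theorem card_le_card_blocks_of_sparse {s : ℕ} {b : ℕ → ℕ} (𝓑 : Multiset (Finset V))
    (hb : ∀ Z : Finset V, s ≤ #Z → #Z ≤ 2 * s → b #Z ≤ blockCount 𝓑 Z)
    (ha : ∀ j ∈ range (s + 1), 0 ≤ aCoeff s b j)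
    (S : Finset (Finset V)) (hS : ∀ X ∈ S, #X = s)
    (hsparse : ∀ X ∈ S, ((∑ Y ∈ S, excess 𝓑 b X Y : ℕ) : ℤ) < aCoeff s b s) :
    #S ≤ 𝓑.card := by
  let M : Matrix 𝓑 S ℝ := Matrix.of fun i X => if X.1 ⊆ i.1 then 1 else 0
  have hinj : Function.Injective M.mulVecLin := by
    rw [← LinearMap.ker_eq_bot, LinearMap.ker_eq_bot']
    intro w hw
    have hzero : ∑ i : 𝓑, (∑ X : S, if X.1 ⊆ i.1 then w X else 0) ^ 2 = 0 := by
      refine sum_eq_zero fun i _ => ?_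
      have := congrFun hw i
      simp only [Matrix.mulVecLin_apply, Matrix.mulVec, dotProduct, M, Matrix.of_apply, ite_mul,
        one_mul, zero_mul, Pi.zero_apply] at this
      rw [this]; simp
    rw [sum_sq_indicator univ (fun (i : 𝓑) (X : S) => X.1 ⊆ i.1)] at hzero
    -- The Gram matrix splits into prescribed part, excess, and surplus on the diagonal.
    have hent : ∀ X Y : S, (b (2 * s - #(X.1 ∩ Y.1)) : ℝ) + excess 𝓑 b X Y
          + (if X = Y then (blockCount 𝓑 X.1 : ℝ) - b s else 0)
        = #{i : 𝓑 | X.1 ⊆ i.1 ∧ Y.1 ⊆ i.1} := by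
      intro X Y
      simp_rw [← union_subset_iff]
      rw [← blockCount_eq_card]
      by_cases h : X = Y
      · subst h
        simp [excess_self, hS X.1 X.2, two_mul]
      · have h' : X.1 ≠ Y.1 := fun h' => h (Subtype.ext h')
        have hun := card_union_add_card_inter X.1 Y.1
        have h1 := hS X.1 X.2
        have h2 := hS Y.1 Y.2
        have h3 : #X.1 ≤ #(X.1 ∪ Y.1) := card_le_card subset_union_left
        have h4 := hb (X.1 ∪ Y.1) (by omega) (by omega)
        rw [show 2 * s - #(X.1 ∩ Y.1) = #(X.1 ∪ Y.1) by omega]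
        simp only [excess, h, h', if_false, Nat.cast_sub h4]
        ring
    simp_rw [← hent, mul_add, sum_add_distrib] at hzero
    have h1 := quadratic_prescribed_ge (fun X : S => X.1) Subtype.val_injective
      (fun X => hS X.1 X.2) ha w
    have h2 := sum_weight_ge (fun X Y : S => (excess 𝓑 b X.1 Y.1 : ℝ)) (fun _ _ => by positivity)
      -- Integrality turns degree `< a_s` into `≤ a_s - 1`, leaving a full `∑ X, w X ^ 2` in the
      -- final estimate.
      (fun X Y => by rw [excess_comm]) (a := (aCoeff s b s : ℝ) - 1) (fun X => by
        have := hsparse X.1 X.2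
        rw [← sum_coe_sort S] at this
        have : ((∑ Y : S, excess 𝓑 b X.1 Y.1 : ℕ) : ℤ) ≤ aCoeff s b s - 1 := by omega
        exact_mod_cast this) w
    have h3 : 0 ≤ ∑ X : S, ∑ Y : S, w X * w Y
        * (if X = Y then (blockCount 𝓑 X.1 : ℝ) - b s else 0) := by
      simp only [mul_ite, mul_zero, sum_ite_eq, mem_univ, if_true]
      refine sum_nonneg fun X _ => mul_nonneg (mul_self_nonneg _) ?_
      have := hb X.1 (hS X.1 X.2).ge (by have := hS X.1 X.2; omega)
      rw [hS X.1 X.2] at this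
      rw [sub_nonneg]
      exact_mod_cast this
    have h4 : ∑ X, w X ^ 2 = 0 :=
      le_antisymm (by linarith) (sum_nonneg fun _ _ => sq_nonneg _)
    ext X
    simpa using (sum_eq_zero_iff_of_nonneg fun _ _ => sq_nonneg _).1 h4 X (mem_univ X)
  simpa using LinearMap.finrank_le_finrank_of_injective hinj

/-! ### Double counting the degrees -/

/-- Both sides count pairs of a block `B ⊇ X` and an `s`-set `Y ⊆ B`. -/
theorem sum_blockCount_union {k : ℕ} (s : ℕ) (𝓑 : Multiset (Finset V)) (h𝓑 : ∀ B ∈ 𝓑, #B = k)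
    (X : Finset V) :
    ∑ Y ∈ powersetCard s univ, blockCount 𝓑 (X ∪ Y) = blockCount 𝓑 X * k.choose s := by
  induction 𝓑 using Multiset.induction with
  | empty => simp [blockCount]
  | cons B 𝓑 ih =>
    have ih := ih fun B' hB' => h𝓑 B' (Multiset.mem_cons_of_mem hB')
    have hB := h𝓑 B (Multiset.mem_cons_self B 𝓑)
    simp only [blockCount, Multiset.countP_cons] at ih ⊢
    rw [sum_add_distrib, ih, add_mul]
    congr 1
    by_cases hX : X ⊆ B
    · rw [if_pos hX, one_mul, ← card_filter, ← hB, ← card_powersetCard]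
      congr 1
      ext Y
      simp [mem_powersetCard, union_subset_iff, hX, and_comm]
    · simp [union_subset_iff, hX]

theorem card_filter_card_inter (s m : ℕ) (X : Finset V) (hms : m ≤ s) :
    #{Y ∈ powersetCard s (univ : Finset V) | #(X ∩ Y) = m}
      = (#X).choose m * (Fintype.card V - #X).choose (s - m) := by
  rw [← card_compl, ← card_powersetCard, ← card_powersetCard, ← card_product]
  refine card_bij' (fun Y _ => (X ∩ Y, Xᶜ ∩ Y)) (fun p _ => p.1 ∪ p.2) ?_ ?_ ?_ ?_
  · intro Y hY
    simp only [mem_filter, mem_powersetCard, mem_product, inter_subset_left, true_and] at hY ⊢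
    refine ⟨hY.2, ?_⟩
    have : #(Xᶜ ∩ Y) + #(X ∩ Y) = #Y := by
      rw [← card_union_of_disjoint, ← union_inter_distrib_right]
      · rw [union_comm, union_compl, univ_inter]
      · exact disjoint_compl_left.mono inter_subset_left inter_subset_left
    omega
  · rintro ⟨P, Q⟩ h
    simp only [mem_filter, mem_powersetCard, mem_product, subset_univ, true_and] at h ⊢
    obtain ⟨⟨hP, hPm⟩, hQ, hQm⟩ := h
    have hXQ : Disjoint X Q := disjoint_compl_right.mono_right hQ
    refine ⟨?_, ?_⟩
    · rw [card_union_of_disjoint (hXQ.mono_left hP)]; omega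
    · rw [inter_union_distrib_left, inter_eq_right.2 hP, disjoint_iff_inter_eq_empty.1 hXQ,
        union_empty, hPm]
  · intro Y _
    rw [← union_inter_distrib_right]; simp
  · rintro ⟨P, Q⟩ h
    simp only [mem_powersetCard, mem_product] at h
    obtain ⟨⟨hP, hPm⟩, hQ, hQm⟩ := h
    have hXQ : Disjoint X Q := disjoint_compl_right.mono_right hQ
    have hXP : Disjoint Xᶜ P := disjoint_compl_left.mono_right hP
    simp only [inter_union_distrib_left]
    rw [inter_eq_right.2 hP, inter_eq_right.2 hQ, disjoint_iff_inter_eq_empty.1 hXQ,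
      disjoint_iff_inter_eq_empty.1 hXP, union_empty, empty_union]

theorem sum_prescribed {s : ℕ} (b : ℕ → ℕ) (X : Finset V) (hX : #X = s) :
    ∑ Y ∈ powersetCard s (univ : Finset V), b #(X ∪ Y)
      = ∑ i ∈ range (s + 1), s.choose i * (Fintype.card V - s).choose (s - i) * b (2 * s - i) := by
  rw [← sum_fiberwise_of_maps_to (s := powersetCard s (univ : Finset V)) (t := range (s + 1))
    (g := fun Y => #(X ∩ Y))]
  · refine sum_congr rfl fun i hi => ?_
    rw [mem_range] at hi
    have h := card_filter_card_inter s i X (by omega)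
    rw [hX] at h
    rw [← h, ← smul_eq_mul, ← sum_const]
    refine sum_congr rfl fun Y hY => ?_
    simp only [mem_filter, mem_powersetCard, subset_univ, true_and] at hY
    have := card_union_add_card_inter X Y
    congr 1
    omega
  · intro Y _
    have : #(X ∩ Y) ≤ #X := card_le_card inter_subset_left
    simp only [mem_range]
    omega

/-- The absent loop at `Y = X` accounts for the `- 1` in `k.choose s - 1`. -/
theorem sum_excess {v k s : ℕ} {b : ℕ → ℕ} (hV : Fintype.card V = v) (𝓑 : Multiset (Finset V))
    (h𝓑 : ∀ B ∈ 𝓑, #B = k)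
    (hb : ∀ Z : Finset V, s ≤ #Z → #Z ≤ 2 * s → b #Z ≤ blockCount 𝓑 Z)
    (X : Finset V) (hX : #X = s) :
    ((∑ Y ∈ powersetCard s univ, excess 𝓑 b X Y : ℕ) : ℤ)
      = dParam v k s b + ((blockCount 𝓑 X : ℤ) - b s) * ((k.choose s : ℤ) - 1) := by
  have hpt : ∀ Y ∈ powersetCard s (univ : Finset V), ((excess 𝓑 b X Y : ℕ) : ℤ)
      = blockCount 𝓑 (X ∪ Y) - b #(X ∪ Y)
        - (if X = Y then (blockCount 𝓑 X : ℤ) - b s else 0) := by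
    intro Y hY
    have hY' := (mem_powersetCard.1 hY).2
    by_cases h : X = Y
    · subst h; simp [excess, hX]
    · have h1 : #X ≤ #(X ∪ Y) := card_le_card subset_union_left
      have h2 := card_union_le X Y
      simp [excess, h, Nat.cast_sub (hb (X ∪ Y) (by omega) (by omega))]
  have hXm : X ∈ powersetCard s (univ : Finset V) := by simp [mem_powersetCard, hX]
  rw [Nat.cast_sum, sum_congr rfl hpt, sum_sub_distrib, sum_sub_distrib, sum_ite_eq, if_pos hXm]
  have h1 := sum_blockCount_union s 𝓑 h𝓑 X
  have h2 := sum_prescribed b X hX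
  rw [sum_range_succ, hV] at h2
  zify at h1 h2
  rw [h1, h2, dParam, show 2 * s - s = s by omega]
  simp
  ring

/-! ### Assembling the bound -/

/-- The bound for a single covering. -/
theorem CB_le_card_blocks {v k s : ℕ} {b : ℕ → ℕ} (hV : Fintype.card V = v)
    (𝓑 : Multiset (Finset V)) (h𝓑 : ∀ B ∈ 𝓑, #B = k) (hsk : s ≤ k)
    (hb : ∀ Z : Finset V, s ≤ #Z → #Z ≤ 2 * s → b #Z ≤ blockCount 𝓑 Z)
    (hnonneg : ∀ j ∈ range (s + 1), 0 ≤ aCoeff s b j)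
    (hda : aCoeff s b s ≤ dParam v k s b) (ha : 1 ≤ aCoeff s b s) :
    CB v k s (b s) (((aCoeff s b s : ℝ) + 1) / (2 * ((dParam v k s b : ℝ) + 1)))
      (((aCoeff s b s : ℝ) + 1) / (2 * ((dParam v k s b : ℝ) + (k.choose s : ℝ))))
      ≤ (𝓑.card : ℝ) := by
  obtain ⟨m, hm⟩ := Int.eq_ofNat_of_zero_le (show 0 ≤ aCoeff s b s by omega)
  obtain ⟨g, hg⟩ : ∃ g : ℕ, k.choose s = g + 1 := ⟨k.choose s - 1, by
    have := Nat.choose_pos hsk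
    omega⟩
  have hm0 : 0 < m := by omega
  set d : ℝ := (dParam v k s b : ℝ) with hd
  have hd0 : 0 ≤ d := by
    have : 0 ≤ dParam v k s b := by omega
    rw [hd]
    exact_mod_cast this
  have hexc := sum_excess hV 𝓑 h𝓑 hb
  obtain ⟨S, hSW, hS, hcard⟩ := exists_sparse_subset (excess 𝓑 b) (excess_comm 𝓑 b)
    (excess_self 𝓑 b) hm0 (powersetCard s univ)
  have hSB : #S ≤ 𝓑.card := card_le_card_blocks_of_sparse 𝓑 hb hnonneg S
    (fun X hX => (mem_powersetCard.1 (hSW hX)).2) (fun X hX => by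
      rw [hm]; exact_mod_cast hS X hX)
  have hSB' : (#S : ℝ) ≤ 𝓑.card := by exact_mod_cast hSB
  set α : ℝ := ((m : ℝ) + 1) / (2 * (d + 1)) with hα
  set β : ℝ := ((m : ℝ) + 1) / (2 * (d + ((g : ℝ) + 1))) with hβ
  have hweight : ∀ X ∈ powersetCard s (univ : Finset V),
      α - (α - β) * ((blockCount 𝓑 X : ℝ) - b s)
        ≤ sparseWeight m (∑ Y ∈ powersetCard s univ, excess 𝓑 b X Y) := by
    intro X hX
    have hXs := (mem_powersetCard.1 hX).2
    have hbX : b s ≤ blockCount 𝓑 X := by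
      have := hb X hXs.ge (by omega)
      rwa [hXs] at this
    obtain ⟨n, hn⟩ := Nat.exists_eq_add_of_le hbX
    have h := hexc X hXs
    rw [hn, hg] at h
    push_cast at h
    have h' : ((∑ Y ∈ powersetCard s univ, excess 𝓑 b X Y : ℕ) : ℤ)
        = dParam v k s b + n * g := by push_cast; rw [h]; ring
    -- Every degree is at least `d ≥ a_s = m`, so only the hyperbolic branch of the weight occurs.
    have hle : m ≤ ∑ Y ∈ powersetCard s univ, excess 𝓑 b X Y := by
      have : 0 ≤ (n : ℤ) * g := by positivity
      zify
      push_cast at h'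
      omega
    rw [sparseWeight_of_le hm0 hle]
    have h'' : ((∑ Y ∈ powersetCard s univ, excess 𝓑 b X Y : ℕ) : ℝ) = d + n * g := by
      have := congrArg (Int.cast : ℤ → ℝ) h'
      rw [Int.cast_natCast] at this
      rw [this, hd]
      push_cast
      rfl
    rw [h'', hn]
    have hn01 : (n : ℝ) = 0 ∨ (1 : ℝ) ≤ n := by
      rcases Nat.eq_zero_or_pos n with h | h
      · left; simp [h]
      · right; exact_mod_cast h
    have := chord_le (A := (m : ℝ) + 1) (by positivity) hd0 (Nat.cast_nonneg g) hn01
    push_cast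
    rw [add_sub_cancel_left]
    exact this
  have hsum := (sum_le_sum hweight).trans (hcard.trans hSB')
  have hcount : ∑ X ∈ powersetCard s (univ : Finset V), (blockCount 𝓑 X : ℝ)
      = 𝓑.card * ((g : ℝ) + 1) := by
    -- All blocks contain `∅`, so this case gives the total over all `s`-sets.
    have h := sum_blockCount_union s 𝓑 h𝓑 ∅
    have h0 : blockCount 𝓑 ∅ = 𝓑.card := by simp [blockCount]
    simp only [empty_union] at h
    rw [hg, h0] at h
    exact_mod_cast h
  rw [sum_sub_distrib, ← mul_sum, sum_sub_distrib, hcount, sum_const, sum_const, card_powersetCard,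
    card_univ, hV, nsmul_eq_mul, nsmul_eq_mul] at hsum
  have hαβ : 0 ≤ α - β := by
    rw [sub_nonneg]
    have : (0 : ℝ) ≤ g := by positivity
    exact div_le_div_of_nonneg_left (by positivity) (by positivity) (by linarith)
  have hmR : (aCoeff s b s : ℝ) = m := by rw [hm]; simp
  have hgR : (k.choose s : ℝ) = g + 1 := by rw [hg]; simp
  rw [hmR, hgR, ← hα, ← hβ, CB, hgR, div_le_iff₀ (by positivity)]
  linarith

end Design

end CoveringDesign

theorem theorem5p2 (t v k lam s : ℕ)
    (ht : 0 < t) (hv : 0 < v) (hk : 0 < k) (hlam : 0 < lam) (hs : 0 < s)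
    (htk : t < k) (hkv : k < v) (hst : s ≤ t / 2)
    -- only the values `b s, …, b (2 * s)` matter
    (b : ℕ → ℕ) (hb : ∀ i ∈ Finset.Icc s (2 * s), 0 < b i)
    (hi : CoveringDesign.schoenheim lam (v - 2 * s) (k - 2 * s) (t - 2 * s) ≤ b (2 * s) ∧
      b (2 * s) ≤ CoveringDesign.coveringNumber lam (v - 2 * s) (k - 2 * s) (t - 2 * s))
    (hii : ∀ i ∈ Finset.Ico s (2 * s),
      ⌈((v : ℚ) - (i : ℚ)) / ((k : ℚ) - (i : ℚ)) * (b (i + 1) : ℚ)⌉₊ ≤ b i ∧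
      b i ≤ CoveringDesign.coveringNumber lam (v - i) (k - i) (t - i))
    (hiii : ∀ j ∈ Finset.range (s + 1), 0 ≤ CoveringDesign.aCoeff s b j)
    (hbs : b s < k.choose s)
    (hda : CoveringDesign.aCoeff s b s ≤ CoveringDesign.dParam v k s b)
    (ha : 1 ≤ CoveringDesign.aCoeff s b s) :
    ⌈CoveringDesign.CB v k s (b s)
        (((CoveringDesign.aCoeff s b s : ℝ) + 1)
          / (2 * ((CoveringDesign.dParam v k s b : ℝ) + 1)))
        (((CoveringDesign.aCoeff s b s : ℝ) + 1)
          / (2 * ((CoveringDesign.dParam v k s b : ℝ) + (k.choose s : ℝ))))⌉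
      ≤ (CoveringDesign.coveringNumber lam v k t : ℤ) := by
  have hcov := Nat.sInf_mem (s := {n : ℕ | ∃ 𝓑 : Multiset (Finset (Fin v)),
    CoveringDesign.IsCovering t v k lam 𝓑 ∧ 𝓑.card = n}) (by
      obtain ⟨𝓑, h⟩ := CoveringDesign.exists_isCovering lam htk.le hkv.le
      exact ⟨_, 𝓑, h, rfl⟩)
  obtain ⟨𝓑, h𝓑, hcard⟩ := hcov
  rw [CoveringDesign.coveringNumber, if_neg ht.ne', ← hcard, Int.ceil_le, Int.cast_natCast]
  refine CoveringDesign.CB_le_card_blocks h𝓑.card_points 𝓑 h𝓑.card_block (by omega) ?_ hiii hda ha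
  intro Z hZ1 hZ2
  refine le_trans ?_ (CoveringDesign.coveringNumber_le_blockCount h𝓑 Z (by omega))
  rcases hZ2.eq_or_lt with h | h
  · rw [h]; exact hi.2
  · exact (hii _ (Finset.mem_Ico.2 ⟨hZ1, h⟩)).2
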